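/- Let $P>0$ and $0<\epsilon<1$; logarithms and relative entropies are in natural units. For $n\ge 1$ the $n$-th random transformation of the $AWGN(P)$ channel has input space $\mathcal X_n=\{x\in\mathbb R^n:\|x\|_2\le\sqrt{nP}\}$, output space $\mathbb R^n$ and transition kernel $P_{Y^n|X^n=x}=\mathcal N(x,\mathbf I_n)$. An $(n,M,\epsilon)_{max,det}$ code consists of a deterministic encoder $\mathsf f:\{1,\dots,M\}\to\mathcal X_n$ and a (possibly randomized) decoder, i.e. a Markov kernel $\mathsf g$ from $\mathbb R^n$ to $\{1,\dots,M\}$, such that in the Markov chain $W\to X^n\to Y^n\to\hat W$ given by $\mathsf f$, $P_{Y^n|X^n}$ and $\mathsf g$ one has $\mathbb P[\hat W\ne W\mid W=j]\le\epsilon$ for every $j\in\{1,\dots,M\}$. Its output distribution $P_{Y^n}$ is the law of $Y^n$ when $W$ is equiprobable on $\{1,\dots,M\}$. Put $C=\tfrac12\log(1+P)$ and $P^*_{Y^n}=\mathcal N(0,1+P)^n$ (the $n$-fold product measure). **Theorem.** For any $0<\epsilon<1$ and $P>0$ there exists a constant $a=a(\epsilon,P)>0$ such that for every $n\ge1$,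 every $M$ and every $(n,M,\epsilon)_{max,det}$ code for the $AWGN(P)$ channel, the relative entropy $D(P_{Y^n}\|P^*_{Y^n})$ is finite and $$D(P_{Y^n}\|P^*_{Y^n})\le nC-\log M+a\sqrt n .$$ In particular, for any capacity-achieving sequence of such codes, i.e. any sequence of $(n,M_n,\epsilon)_{max,det}$ codes, $n=1,2,\dots$, with $\frac1n\log M_n\to C$, one has $$\frac1n D(P_{Y^n}\|P^*_{Y^n})\to0\qquad(n\to\infty).$$ -/

import Mathlib

open MeasureTheory ProbabilityTheory Filter Topology

noncomputable section

namespace ChannelCoding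

section Codes

variable {X Y : Type*} [MeasurableSpace X] [MeasurableSpace Y]

/-- A code with `M` messages for the random transformation `K` from `X` to `Y`: a (possibly
stochastic) encoder `enc` from messages to channel inputs and a (possibly stochastic) decoder
`dec` from channel outputs to messages. The set of messages is `Fin M`. -/
structure Code (K : Kernel X Y) (M : ℕ) where
  enc : Kernel (Fin M) X
  dec : Kernel Y (Fin M)
  isMarkovKernel_enc : IsMarkovKernel enc
  isMarkovKernel_dec : IsMarkovKernel dec

variable {K : Kernel X Y} {M : ℕ}

/-- The conditional law of the decoded message `Ŵ` given the message `W`, in the Markov chain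
`W → X → Y → Ŵ` given by the encoder, the random transformation and the decoder. -/
def Code.decodedLaw (c : Code K M) : Kernel (Fin M) (Fin M) :=
  c.dec ∘ₖ (K ∘ₖ c.enc)

/-- The conditional probability of error `ℙ[Ŵ ≠ W | W = j]`. -/
def Code.errorProb (c : Code K M) (j : Fin M) : ℝ :=
  (c.decodedLaw j).real {i | i ≠ j}

/-- The maximal probability of error is at most `ε`. -/
def Code.MaxErrorLE (c : Code K M) (ε : ℝ) : Prop :=
  ∀ j : Fin M, c.errorProb j ≤ ε

/-- The encoder is a functional (non-random) mapping. -/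
def Code.IsDeterministic (c : Code K M) : Prop :=
  ∃ (f : Fin M → X) (hf : Measurable f), c.enc = Kernel.deterministic f hf

/-- `c` is an `(M, ε)_{max,det}` code. -/
def Code.IsMaxDet (c : Code K M) (ε : ℝ) : Prop :=
  c.MaxErrorLE ε ∧ c.IsDeterministic

/-- The input distribution `P_X` induced by the encoder, with the message equiprobable. -/
def Code.inputDist (c : Code K M) : Measure X :=
  c.enc ∘ₘ (uniformOn (Set.univ : Set (Fin M)))

/-- The output distribution `P_Y` induced by the encoder, with the message equiprobable. -/
def Code.outputDist (c : Code K M) : Measure Y :=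
  K ∘ₘ c.inputDist

end Codes

section AWGN

/-- The input space of the AWGN channel with blocklength `n` and power constraint `P`. -/
abbrev AWGNInput (n : ℕ) (P : ℝ) : Type :=
  {x : EuclideanSpace ℝ (Fin n) // ‖x‖ ≤ √(n * P)}

lemma measurable_multivariateGaussian_one (n : ℕ) :
    Measurable fun x : EuclideanSpace ℝ (Fin n) ↦ multivariateGaussian x 1 := by
  have h : (fun x : EuclideanSpace ℝ (Fin n) ↦ multivariateGaussian x 1)
      = fun x ↦ ((Kernel.id ×ₖ Kernel.const (EuclideanSpace ℝ (Fin n))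
          (multivariateGaussian (0 : EuclideanSpace ℝ (Fin n)) 1)).map
            (fun p ↦ p.1 + p.2)) x := by
    funext x
    rw [Kernel.map_apply _ (by fun_prop), Kernel.prod_apply, Kernel.id_apply, Kernel.const_apply,
      Measure.dirac_prod, Measure.map_map (by fun_prop) (by fun_prop), multivariateGaussian,
      multivariateGaussian, Measure.map_map (by fun_prop) (by fun_prop)]
    congr 1
    funext y
    simp
  rw [h]
  exact Kernel.measurable _

/-- The `n`-th random transformation of the `AWGN(P)` channel: given the input `x`, the output is
distributed as the normal distribution with mean `x` and identity covariance matrix. -/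
def awgn (n : ℕ) (P : ℝ) : Kernel (AWGNInput n P) (EuclideanSpace ℝ (Fin n)) where
  toFun x := multivariateGaussian (x : EuclideanSpace ℝ (Fin n)) 1
  measurable' := (measurable_multivariateGaussian_one n).comp measurable_subtype_coe

instance (n : ℕ) (P : ℝ) : IsMarkovKernel (awgn n P) :=
  ⟨fun x ↦ inferInstanceAs
    (IsProbabilityMeasure (multivariateGaussian (x : EuclideanSpace ℝ (Fin n)) 1))⟩

/-- The capacity of the `AWGN(P)` channel, in nats. -/
def awgnCapacity (P : ℝ) : ℝ := 1 / 2 * Real.log (1 + P)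

/-- The capacity-achieving output distribution of the `AWGN(P)` channel: the `n`-fold product of
the normal distribution with mean `0` and variance `1 + P`, as a measure on Euclidean space. -/
def awgnCaod (n : ℕ) (P : ℝ) : Measure (EuclideanSpace ℝ (Fin n)) :=
  (Measure.pi fun _ : Fin n ↦ gaussianReal 0 (Real.toNNReal (1 + P))).map (WithLp.toLp 2)

end AWGN

end ChannelCoding

end

/-! With `P_j = N(x_j, I)`, the output law `Q` is the uniform mixture of the `P_j`, so `D(Q‖P*)` is
the average of `D(P_j‖P*)` minus the average of `D(P_j‖Q)`. The power constraint bounds the first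
average by `nC` (`integral_logDensity_le`), so it remains to show that the second is at least `log M
- O(√n)`.

This is a strong converse with auxiliary measure `Q` (`log_card_le_average_add`). Under `P_j`,
message `j` is decoded correctly with probability at least `1 - ε`. If the information density `log
dP_j/dQ` is concentrated near its mean `m_j = D(P_j‖Q)`, changing measure to `Q` costs a factor
`exp(m_j + Δ)`. The decoding probabilities under `Q` sum to `1`, and Jensen's inequality then yields
`log M ≤ avg m_j + Δ + O(1)`. The threshold must depend on `j`, since the `m_j` need not be close to
each other.

For `Δ = O(√n)` the variance of the information density has to be `O(n)`. Centred at `x_j`, the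
density is a constant minus a log-sum-exp of affine functions with slopes `x_k - x_j`
(`logDensity_sub_mixLogDensity_add`). This is convex with gradient of norm at most `2√(nP)`, so a
dimension-free Gaussian Poincaré inequality (`HasBoundedSubgradient.variance_le`) applies. -/

noncomputable section

namespace ChannelCoding

/-! ### Gaussian Poincaré inequality for convex Lipschitz functions, by rotation of independent
pairs. -/

section Poincare

set_option linter.unusedSectionVars false

variable {E : Type*} [NormedAddCommGroup E] [InnerProductSpace ℝ E] [FiniteDimensional ℝ E]
  [MeasurableSpace E] [BorelSpace E]

lemma memLp_inner_stdGaussian (v : E) :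
    MemLp (fun w : E ↦ inner ℝ v w) 2 (stdGaussian E) :=
  (IsGaussian.memLp_two_id (μ := stdGaussian E)).const_inner v

lemma integral_inner_stdGaussian (v : E) : ∫ w, inner ℝ v w ∂(stdGaussian E) = 0 :=
  integral_strongDual_stdGaussian (innerSL ℝ v)

lemma integral_inner_sq_stdGaussian (v : E) :
    ∫ w, (inner ℝ v w) ^ 2 ∂(stdGaussian E) = ‖v‖ ^ 2 := by
  have h := variance_dual_stdGaussian (E := E) (innerSL ℝ v)
  rw [variance_eq_integral (by fun_prop), integral_strongDual_stdGaussian] at h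
  simpa using h

lemma memLp_norm_stdGaussian : MemLp (fun z : E ↦ ‖z‖) 2 (stdGaussian E) :=
  (IsGaussian.memLp_two_id (μ := stdGaussian E)).norm

lemma integrable_norm_sq_stdGaussian : Integrable (fun z : E ↦ ‖z‖ ^ 2) (stdGaussian E) :=
  (IsGaussian.memLp_two_id (μ := stdGaussian E)).norm.integrable_sq

/-- The first coordinate of the rotation by `θ` of a pair. -/
def rot (θ : ℝ) (p : E × E) : E := Real.cos θ • p.1 + Real.sin θ • p.2

@[fun_prop]
lemma continuous_rot (θ : ℝ) : Continuous (rot θ : E × E → E) := by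
  unfold rot; fun_prop

lemma rot_rotation (θ φ : ℝ) (p : E × E) :
    rot θ (ContinuousLinearMap.rotation φ p) = rot (θ + φ) p := by
  simp only [rot, ContinuousLinearMap.rotation_apply, Real.cos_add, Real.sin_add]
  module

lemma measurePreserving_rotation (θ : ℝ) :
    MeasurePreserving (ContinuousLinearMap.rotation θ : E × E →L[ℝ] E × E)
      ((stdGaussian E).prod (stdGaussian E)) ((stdGaussian E).prod (stdGaussian E)) :=
  ⟨by fun_prop, IsGaussian.map_rotation_eq_self integral_id_stdGaussian θ⟩

lemma integral_comp_rotation {f : E × E → ℝ} (hf : Measurable f) (θ : ℝ) :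
    ∫ p, f (ContinuousLinearMap.rotation θ p) ∂((stdGaussian E).prod (stdGaussian E))
      = ∫ p, f p ∂((stdGaussian E).prod (stdGaussian E)) := by
  conv_rhs => rw [← (measurePreserving_rotation θ).map_eq]
  rw [integral_map (by fun_prop) hf.aestronglyMeasurable]

lemma memLp_rot (θ : ℝ) :
    MemLp (rot θ : E × E → E) 2 ((stdGaussian E).prod (stdGaussian E)) :=
  (((IsGaussian.memLp_two_id (μ := stdGaussian E)).comp_fst _).const_smul (Real.cos θ)).add
    (((IsGaussian.memLp_two_id (μ := stdGaussian E)).comp_snd _).const_smul (Real.sin θ))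

/-- `g` selects a subgradient of `F` at every point, and these subgradients have norm at most
`L`. -/
structure HasBoundedSubgradient (F : E → ℝ) (g : E → E) (L : ℝ) : Prop where
  measurable : Measurable g
  norm_le : ∀ v, ‖g v‖ ≤ L
  le : ∀ u v, F v + inner ℝ (g v) (u - v) ≤ F u

variable {F : E → ℝ} {g : E → E} {L : ℝ}

namespace HasBoundedSubgradient

lemma nonneg (h : HasBoundedSubgradient F g L) : 0 ≤ L := (norm_nonneg _).trans (h.norm_le 0)

lemma abs_sub_le (h : HasBoundedSubgradient F g L) (u v : E) : |F u - F v| ≤ L * ‖u - v‖ := by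
  have key : ∀ u v, F v - F u ≤ L * ‖u - v‖ := fun u v ↦ by
    have h1 := h.le u v
    have h2 := abs_real_inner_le_norm (g v) (u - v)
    have h3 := mul_le_mul_of_nonneg_right (h.norm_le v) (norm_nonneg (u - v))
    have h4 := neg_abs_le (inner ℝ (g v) (u - v))
    linarith
  have h1 := key u v
  have h2 := key v u
  rw [norm_sub_rev] at h2
  exact abs_le.2 ⟨by linarith, h2⟩

lemma lipschitzWith (h : HasBoundedSubgradient F g L) : LipschitzWith L.toNNReal F :=
  LipschitzWith.of_dist_le_mul fun u v ↦ by
    rw [Real.dist_eq, dist_eq_norm, Real.coe_toNNReal _ h.nonneg]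
    exact h.abs_sub_le u v

lemma memLp_two (h : HasBoundedSubgradient F g L) : MemLp F 2 (stdGaussian E) := by
  have h0 : MemLp (fun z : E ↦ |F 0| + L * ‖z‖) 2 (stdGaussian E) :=
    MemLp.add (f := fun _ ↦ |F 0|) (g := fun z ↦ L * ‖z‖) (memLp_const _)
      (memLp_norm_stdGaussian.const_mul L)
  refine h0.mono h.lipschitzWith.continuous.aestronglyMeasurable (ae_of_all _ fun z ↦ ?_)
  have h1 := h.abs_sub_le z 0
  rw [sub_zero] at h1
  have h2 := abs_add_le (F z - F 0) (F 0)
  rw [sub_add_cancel] at h2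
  rw [Real.norm_eq_abs, Real.norm_eq_abs]
  exact (by linarith : |F z| ≤ |F 0| + L * ‖z‖).trans (le_abs_self _)

/-- The subgradient at whichever point has the larger value controls the difference; summing both
squares avoids tracking which point that is. -/
lemma sq_sub_le (h : HasBoundedSubgradient F g L) (u v : E) :
    (F u - F v) ^ 2 ≤ (inner ℝ (g u) (u - v)) ^ 2 + (inner ℝ (g v) (v - u)) ^ 2 := by
  have h1 := h.le u v
  have h2 := h.le v u
  have e1 : inner ℝ (g u) (v - u) = - inner ℝ (g u) (u - v) := by
    rw [← inner_neg_right, neg_sub]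
  have e2 : inner ℝ (g v) (u - v) = - inner ℝ (g v) (v - u) := by
    rw [← inner_neg_right, neg_sub]
  rw [e1] at h2
  rw [e2] at h1
  rcases le_total 0 (F u - F v) with h0 | h0
  · have : (F u - F v) ^ 2 ≤ (inner ℝ (g u) (u - v)) ^ 2 :=
      pow_le_pow_left₀ h0 (by linarith) 2
    nlinarith [sq_nonneg (inner ℝ (g v) (v - u))]
  · have : (F v - F u) ^ 2 ≤ (inner ℝ (g v) (v - u)) ^ 2 :=
      pow_le_pow_left₀ (by linarith) (by linarith) 2
    nlinarith [sq_nonneg (inner ℝ (g u) (u - v))]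

lemma memLp_inner (h : HasBoundedSubgradient F g L) (θ : ℝ) :
    MemLp (fun p : E × E ↦ inner ℝ (g p.1) (p.1 - rot θ p)) 2
      ((stdGaussian E).prod (stdGaussian E)) := by
  have h0 : MemLp (fun p : E × E ↦ L * ‖p.1 - rot θ p‖) 2
      ((stdGaussian E).prod (stdGaussian E)) :=
    (((IsGaussian.memLp_two_id (μ := stdGaussian E)).comp_fst _).sub (memLp_rot θ)).norm.const_mul L
  have hm := h.measurable
  refine h0.mono ?_ (ae_of_all _ fun p ↦ ?_)
  · exact (Measurable.inner (by fun_prop) (by fun_prop)).aestronglyMeasurable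
  · rw [Real.norm_eq_abs, Real.norm_eq_abs]
    exact (abs_real_inner_le_norm _ _).trans
      ((mul_le_mul_of_nonneg_right (h.norm_le _) (norm_nonneg _)).trans (le_abs_self _))

/-- Given `z = p.1`, the increment is `(1 - cos θ) z - sin θ w` with `w` independent of `z`. The
cross term has mean zero, and the `w` part contributes only `sin² θ ‖g z‖²`. The dimension enters
solely through `E‖z‖²`, whose coefficient is of order `θ⁴`. -/
lemma integral_inner_sq_le (h : HasBoundedSubgradient F g L) (θ : ℝ) :
    ∫ p, (inner ℝ (g p.1) (p.1 - rot θ p)) ^ 2 ∂((stdGaussian E).prod (stdGaussian E))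
      ≤ (1 - Real.cos θ) ^ 2 * L ^ 2 * (∫ z, ‖z‖ ^ 2 ∂(stdGaussian E))
        + Real.sin θ ^ 2 * L ^ 2 := by
  rw [integral_prod _ (h.memLp_inner θ).integrable_sq]
  have hin : ∀ z : E, ∫ w, (inner ℝ (g z) (z - rot θ (z, w))) ^ 2 ∂(stdGaussian E)
      = ((1 - Real.cos θ) * inner ℝ (g z) z) ^ 2 + Real.sin θ ^ 2 * ‖g z‖ ^ 2 := fun z ↦ by
    have e : ∀ w, (inner ℝ (g z) (z - rot θ (z, w))) ^ 2
        = ((1 - Real.cos θ) * inner ℝ (g z) z) ^ 2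
          + (-2 * ((1 - Real.cos θ) * inner ℝ (g z) z) * Real.sin θ) * inner ℝ (g z) w
          + Real.sin θ ^ 2 * (inner ℝ (g z) w) ^ 2 := fun w ↦ by
      simp only [rot, inner_sub_right, inner_add_right, inner_smul_right]
      ring
    simp_rw [e]
    have i1 := (memLp_inner_stdGaussian (g z)).integrable one_le_two
    have i2 := (memLp_inner_stdGaussian (g z)).integrable_sq
    rw [integral_add (by fun_prop) (by fun_prop), integral_add (by fun_prop) (by fun_prop), integral_const_mul, integral_const_mul,
      integral_inner_stdGaussian, integral_inner_sq_stdGaussian]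
    simp
  simp only [hin]
  calc _ ≤ ∫ z, ((1 - Real.cos θ) ^ 2 * L ^ 2 * ‖z‖ ^ 2 + Real.sin θ ^ 2 * L ^ 2)
            ∂(stdGaussian E) := by
        refine integral_mono_of_nonneg (ae_of_all _ fun z ↦ by positivity)
          ((integrable_norm_sq_stdGaussian.const_mul _).add (integrable_const _))
          (ae_of_all _ fun z ↦ ?_)
        have h1 : (inner ℝ (g z) z) ^ 2 ≤ (L * ‖z‖) ^ 2 := by
          rw [← sq_abs]
          refine pow_le_pow_left₀ (abs_nonneg _) ((abs_real_inner_le_norm _ _).trans ?_) 2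
          exact mul_le_mul_of_nonneg_right (h.norm_le _) (norm_nonneg _)
        have h2 : ‖g z‖ ^ 2 ≤ L ^ 2 := pow_le_pow_left₀ (norm_nonneg _) (h.norm_le _) 2
        have h3 := mul_le_mul_of_nonneg_left h1 (sq_nonneg (1 - Real.cos θ))
        have h4 := mul_le_mul_of_nonneg_left h2 (sq_nonneg (Real.sin θ))
        dsimp only
        linarith [mul_pow (1 - Real.cos θ) (inner ℝ (g z) z) 2, mul_pow L ‖z‖ 2]
    _ = _ := by
        rw [integral_add (integrable_norm_sq_stdGaussian.const_mul _) (integrable_const _),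
          integral_const_mul]
        simp

lemma memLp_comp_rot (h : HasBoundedSubgradient F g L) (θ : ℝ) :
    MemLp (fun p : E × E ↦ F (rot θ p)) 2 ((stdGaussian E).prod (stdGaussian E)) := by
  have h1 : MemLp (fun p : E × E ↦ F p.1) 2 ((stdGaussian E).prod (stdGaussian E)) :=
    h.memLp_two.comp_fst _
  have h2 := h1.comp_measurePreserving (measurePreserving_rotation θ)
  exact h2

/-- In the pair rotated by `θ`, the first coordinate is `rot θ p`, and rotating back by `-θ`
recovers `p.1`. Rotation invariance thus reduces the subgradient term at `rot θ p` to the one at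
`p.1` with angle `-θ`. -/
lemma integral_sq_sub_rot_le (h : HasBoundedSubgradient F g L) (θ : ℝ) :
    ∫ p, (F p.1 - F (rot θ p)) ^ 2 ∂((stdGaussian E).prod (stdGaussian E))
      ≤ 2 * ((1 - Real.cos θ) ^ 2 * L ^ 2 * (∫ z, ‖z‖ ^ 2 ∂(stdGaussian E))
        + Real.sin θ ^ 2 * L ^ 2) := by
  have hm := h.measurable
  set f : E × E → ℝ := fun p ↦ (inner ℝ (g p.1) (p.1 - rot (-θ) p)) ^ 2 with hf
  have hfm : Measurable f := (Measurable.inner (by fun_prop) (by fun_prop)).pow_const 2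
  have hfi : Integrable f ((stdGaussian E).prod (stdGaussian E)) :=
    (h.memLp_inner (-θ)).integrable_sq
  have hrot : ∀ p : E × E, (inner ℝ (g (rot θ p)) (rot θ p - p.1)) ^ 2
      = f (ContinuousLinearMap.rotation θ p) := fun p ↦ by
    have e1 : (ContinuousLinearMap.rotation θ p).1 = rot θ p := rfl
    simp only [hf, rot_rotation, e1]
    simp [rot]
  have hi : Integrable (fun p ↦ f (ContinuousLinearMap.rotation θ p))
      ((stdGaussian E).prod (stdGaussian E)) :=
    (measurePreserving_rotation (E := E) θ).integrable_comp_of_integrable hfi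
  calc _ ≤ ∫ p, ((inner ℝ (g p.1) (p.1 - rot θ p)) ^ 2
            + f (ContinuousLinearMap.rotation θ p)) ∂((stdGaussian E).prod (stdGaussian E)) := by
        refine integral_mono_of_nonneg (ae_of_all _ fun z ↦ by positivity)
          ((h.memLp_inner θ).integrable_sq.add hi) (ae_of_all _ fun p ↦ ?_)
        dsimp only
        rw [← hrot]
        exact h.sq_sub_le _ _
    _ = ∫ p, (inner ℝ (g p.1) (p.1 - rot θ p)) ^ 2 ∂((stdGaussian E).prod (stdGaussian E))
          + ∫ p, f p ∂((stdGaussian E).prod (stdGaussian E)) := by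
        rw [integral_add (h.memLp_inner θ).integrable_sq hi, integral_comp_rotation hfm]
    _ ≤ _ := by
        have h1 := h.integral_inner_sq_le θ
        have h2 := h.integral_inner_sq_le (-θ)
        rw [Real.cos_neg, Real.sin_neg, neg_sq] at h2
        linarith

/-- Rotating by a quarter turn in `K` equal steps carries `p.1` to `p.2`; all increments have the
same law, and Cauchy–Schwarz costs one factor `K`. -/
lemma integral_sq_sub_le_of_nat (h : HasBoundedSubgradient F g L) (K : ℕ) (hK : K ≠ 0) :
    ∫ p, (F p.1 - F p.2) ^ 2 ∂((stdGaussian E).prod (stdGaussian E))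
      ≤ K ^ 2 * (2 * ((1 - Real.cos (Real.pi / 2 / K)) ^ 2 * L ^ 2
          * (∫ z, ‖z‖ ^ 2 ∂(stdGaussian E)) + Real.sin (Real.pi / 2 / K) ^ 2 * L ^ 2)) := by
  set θ := Real.pi / 2 / K with hθ
  have hFc := h.lipschitzWith.continuous
  have hd : ∀ k : ℕ, MemLp (fun p : E × E ↦ F (rot (k * θ) p) - F (rot ((k + 1 : ℕ) * θ) p)) 2
      ((stdGaussian E).prod (stdGaussian E)) := fun k ↦
    (h.memLp_comp_rot _).sub (h.memLp_comp_rot _)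
  have hint : ∀ k : ℕ, ∫ p, (F (rot (k * θ) p) - F (rot ((k + 1 : ℕ) * θ) p)) ^ 2
      ∂((stdGaussian E).prod (stdGaussian E))
      = ∫ p, (F p.1 - F (rot θ p)) ^ 2 ∂((stdGaussian E).prod (stdGaussian E)) := fun k ↦ by
    have hm : Measurable fun p : E × E ↦ (F p.1 - F (rot θ p)) ^ 2 := by
      apply Continuous.measurable; fun_prop
    rw [← integral_comp_rotation hm (k * θ)]
    congr with p
    have e1 : (ContinuousLinearMap.rotation (k * θ) p).1 = rot (k * θ) p := rfl
    rw [rot_rotation, e1, show θ + k * θ = (k + 1 : ℕ) * θ by push_cast; ring]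
  calc _ ≤ ∫ p, K * ∑ k ∈ Finset.range K, (F (rot (k * θ) p) - F (rot ((k + 1 : ℕ) * θ) p)) ^ 2
            ∂((stdGaussian E).prod (stdGaussian E)) := by
        refine integral_mono_of_nonneg (ae_of_all _ fun z ↦ by positivity) ?_
          (ae_of_all _ fun p ↦ ?_)
        · exact (integrable_finsetSum _ fun k _ ↦ (hd k).integrable_sq).const_mul _
        · dsimp only
          have h1 := sq_sum_le_card_mul_sum_sq (s := Finset.range K)
            (f := fun k : ℕ ↦ F (rot (k * θ) p) - F (rot ((k + 1 : ℕ) * θ) p))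
          rw [Finset.sum_range_sub', Finset.card_range] at h1
          have e : (K : ℝ) * θ = Real.pi / 2 := by
            rw [hθ]; field_simp
          rw [e] at h1
          simpa [rot] using h1
    _ = K ^ 2 * ∫ p, (F p.1 - F (rot θ p)) ^ 2 ∂((stdGaussian E).prod (stdGaussian E)) := by
        rw [integral_const_mul, integral_finsetSum _ fun k _ ↦ (hd k).integrable_sq]
        simp only [hint, Finset.sum_const, Finset.card_range, nsmul_eq_mul]
        ring
    _ ≤ _ := mul_le_mul_of_nonneg_left (h.integral_sq_sub_rot_le θ) (by positivity)

lemma integral_sq_sub_le (h : HasBoundedSubgradient F g L) :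
    ∫ p, (F p.1 - F p.2) ^ 2 ∂((stdGaussian E).prod (stdGaussian E))
      ≤ Real.pi ^ 2 / 2 * L ^ 2 := by
  set S := ∫ z, ‖z‖ ^ 2 ∂(stdGaussian E) with hS
  have hS0 : 0 ≤ S := integral_nonneg fun z ↦ by positivity
  set A := ∫ p, (F p.1 - F p.2) ^ 2 ∂((stdGaussian E).prod (stdGaussian E))
  set B := (Real.pi / 2) ^ 4 / 2 * L ^ 2 * S
  have hlim : Tendsto (fun K : ℕ ↦ Real.pi ^ 2 / 2 * L ^ 2 + B * ((K : ℝ)⁻¹) ^ 2) atTop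
      (𝓝 (Real.pi ^ 2 / 2 * L ^ 2 + B * 0 ^ 2)) :=
    ((tendsto_inv_atTop_nhds_zero_nat (𝕜 := ℝ)).pow 2 |>.const_mul B).const_add _
  rw [zero_pow two_ne_zero, mul_zero, add_zero] at hlim
  refine ge_of_tendsto hlim ?_
  filter_upwards [eventually_ne_atTop 0] with K hK
  have hK' : (K : ℝ) ≠ 0 := by exact_mod_cast hK
  refine (h.integral_sq_sub_le_of_nat K hK).trans ?_
  set θ := Real.pi / 2 / K with hθ
  -- Since `θ = π / (2K)`, the dimension-dependent term is of order `K² θ⁴`, hence vanishes as `K →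
  -- ∞`, while `2 K² θ² L²` stays equal to `π² / 2 * L²`.
  have h1 : (1 - Real.cos θ) ^ 2 ≤ (θ ^ 2 / 2) ^ 2 :=
    pow_le_pow_left₀ (by linarith [Real.cos_le_one θ])
      (by linarith [Real.one_sub_sq_div_two_le_cos (x := θ)]) 2
  have h2 : Real.sin θ ^ 2 ≤ θ ^ 2 := sq_le_sq.2 Real.abs_sin_le_abs
  calc _ ≤ (K : ℝ) ^ 2 * (2 * ((θ ^ 2 / 2) ^ 2 * L ^ 2 * S + θ ^ 2 * L ^ 2)) := by gcongr
    _ = _ := by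
      rw [hθ]
      simp only [B]
      field_simp
      ring

/-- A dimension-free Poincaré inequality for convex functions under the standard Gaussian
measure. -/
theorem variance_le (h : HasBoundedSubgradient F g L) :
    Var[F; stdGaussian E] ≤ Real.pi ^ 2 / 4 * L ^ 2 := by
  have hi := h.memLp_two.integrable one_le_two
  have hsq := h.memLp_two.integrable_sq
  -- For independent copies, the mean squared difference is twice the variance.
  have key : ∫ p, (F p.1 - F p.2) ^ 2 ∂((stdGaussian E).prod (stdGaussian E))
      = 2 * Var[F; stdGaussian E] := by
    rw [variance_eq_sub h.memLp_two]
    have e : ∀ p : E × E, (F p.1 - F p.2) ^ 2 = F p.1 ^ 2 + F p.2 ^ 2 - 2 * (F p.1 * F p.2) :=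
      fun p ↦ by ring
    simp_rw [e]
    have i1 : Integrable (fun p : E × E ↦ F p.1 ^ 2) ((stdGaussian E).prod (stdGaussian E)) :=
      hsq.comp_fst _
    have i2 : Integrable (fun p : E × E ↦ F p.2 ^ 2) ((stdGaussian E).prod (stdGaussian E)) :=
      hsq.comp_snd _
    have i3 : Integrable (fun p : E × E ↦ F p.1 * F p.2)
        ((stdGaussian E).prod (stdGaussian E)) := hi.mul_prod hi
    rw [integral_sub (by fun_prop) (by fun_prop), integral_add i1 i2, integral_const_mul,
      integral_prod_mul (fun z ↦ F z) (fun z ↦ F z),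
      integral_fun_fst (fun z ↦ F z ^ 2), integral_fun_snd (fun z ↦ F z ^ 2)]
    simp
    ring
  have := h.integral_sq_sub_le
  rw [key] at this
  linarith

end HasBoundedSubgradient

end Poincare

/-! ### Convexity and gradient bound of log-sum-exp. -/

section LogSumExp

variable {ι E : Type*} [Fintype ι] [NormedAddCommGroup E] [InnerProductSpace ℝ E]

/-- The logarithm of a finite sum of exponentials of affine functions. -/
def logSumExp (v : ι → E) (c : ι → ℝ) (z : E) : ℝ :=
  Real.log (∑ k, Real.exp (inner ℝ z (v k) + c k))

/-- The weights of the gradient of `logSumExp`. -/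
def logSumExpWeight (v : ι → E) (c : ι → ℝ) (z : E) (k : ι) : ℝ :=
  Real.exp (inner ℝ z (v k) + c k) / ∑ k, Real.exp (inner ℝ z (v k) + c k)

/-- The gradient of `logSumExp`. -/
def logSumExpGrad (v : ι → E) (c : ι → ℝ) (z : E) : E :=
  ∑ k, logSumExpWeight v c z k • v k

variable [Nonempty ι] {v : ι → E} {c : ι → ℝ}

lemma sum_exp_pos (a : ι → ℝ) : 0 < ∑ k, Real.exp (a k) :=
  Finset.sum_pos (fun _ _ ↦ Real.exp_pos _) Finset.univ_nonempty

lemma logSumExpWeight_nonneg (z : E) (k : ι) : 0 ≤ logSumExpWeight v c z k :=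
  div_nonneg (Real.exp_pos _).le (sum_exp_pos _).le

lemma sum_logSumExpWeight (z : E) : ∑ k, logSumExpWeight v c z k = 1 := by
  simp only [logSumExpWeight]
  rw [← Finset.sum_div, div_self (sum_exp_pos _).ne']

/-- The gradient is a convex combination of the `v k`, which bounds its norm. The subgradient
inequality is Jensen's inequality for `exp` under the softmax weights at the base point. -/
lemma logSumExp_hasBoundedSubgradient [MeasurableSpace E] [BorelSpace E]
    [SecondCountableTopology E] {L : ℝ} (hv : ∀ k, ‖v k‖ ≤ L) :
    HasBoundedSubgradient (logSumExp v c) (logSumExpGrad v c) L where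
  measurable := by
    unfold logSumExpGrad logSumExpWeight
    fun_prop
  norm_le z := by
    calc ‖∑ k, logSumExpWeight v c z k • v k‖ ≤ ∑ k, ‖logSumExpWeight v c z k • v k‖ :=
          norm_sum_le _ _
      _ ≤ ∑ k, logSumExpWeight v c z k * L := by
          refine Finset.sum_le_sum fun k _ ↦ ?_
          rw [norm_smul, Real.norm_of_nonneg (logSumExpWeight_nonneg z k)]
          exact mul_le_mul_of_nonneg_left (hv k) (logSumExpWeight_nonneg z k)
      _ = L := by rw [← Finset.sum_mul, sum_logSumExpWeight, one_mul]
  le u w := by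
    have hJ := convexOn_exp.map_sum_le (t := Finset.univ) (w := logSumExpWeight v c w)
      (p := fun k ↦ inner ℝ (u - w) (v k)) (fun k _ ↦ logSumExpWeight_nonneg w k)
      (sum_logSumExpWeight w) (fun _ _ ↦ Set.mem_univ _)
    simp only [smul_eq_mul] at hJ
    have hg : ∑ k, logSumExpWeight v c w k * inner ℝ (u - w) (v k)
        = inner ℝ (logSumExpGrad v c w) (u - w) := by
      simp only [logSumExpGrad, sum_inner, real_inner_smul_left, real_inner_comm]
    have hs : ∑ k, logSumExpWeight v c w k * Real.exp (inner ℝ (u - w) (v k))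
        = (∑ k, Real.exp (inner ℝ u (v k) + c k)) / ∑ k, Real.exp (inner ℝ w (v k) + c k) := by
      rw [Finset.sum_div]
      refine Finset.sum_congr rfl fun k _ ↦ ?_
      rw [logSumExpWeight, div_mul_eq_mul_div, ← Real.exp_add, inner_sub_left]
      ring_nf
    rw [hg, hs] at hJ
    have h1 := (Real.le_log_iff_exp_le (div_pos (sum_exp_pos _) (sum_exp_pos _))).2 hJ
    rw [Real.log_div (sum_exp_pos _).ne' (sum_exp_pos _).ne'] at h1
    simp only [logSumExp]
    linarith

end LogSumExp

/-! ### Gaussian densities relative to the capacity-achieving output law. -/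

section Densities

lemma pi_withDensity {ι : Type*} [Fintype ι] {α : ι → Type*} [∀ i, MeasurableSpace (α i)]
    (μ : ∀ i, Measure (α i)) [∀ i, IsProbabilityMeasure (μ i)] {f : ∀ i, α i → ENNReal}
    (hf : ∀ i, Measurable (f i)) [∀ i, SigmaFinite ((μ i).withDensity (f i))] :
    Measure.pi (fun i ↦ (μ i).withDensity (f i))
      = (Measure.pi μ).withDensity fun x ↦ ∏ i, f i (x i) := by
  refine Measure.pi_eq fun s hs ↦ ?_
  have hm : ∀ i, Measurable ((s i).indicator (f i)) := fun i ↦ (hf i).indicator (hs i)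
  have hind := iIndepFun_pi (μ := μ) (X := fun i ↦ (s i).indicator (f i))
    fun i ↦ (hm i).aemeasurable
  rw [withDensity_apply _ (MeasurableSet.univ_pi hs), ← lintegral_indicator (.univ_pi hs)]
  -- The density restricted to a box is a product of functions of single coordinates, so
  -- independence factors its integral.
  have e : ∀ x : ∀ i, α i, (Set.univ.pi s).indicator (fun x ↦ ∏ i, f i (x i)) x
      = ∏ i, (s i).indicator (f i) (x i) := fun x ↦ by
    by_cases hx : x ∈ Set.univ.pi s
    · rw [Set.indicator_of_mem hx]
      exact Finset.prod_congr rfl fun i _ ↦ (Set.indicator_of_mem (hx i trivial) _).symm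
    · rw [Set.indicator_of_notMem hx]
      simp only [Set.mem_pi, Set.mem_univ, true_implies, not_forall] at hx
      obtain ⟨i, hi⟩ := hx
      exact (Finset.prod_eq_zero (Finset.mem_univ i) (Set.indicator_of_notMem hi _)).symm
  simp_rw [e]
  rw [lintegral_prod_eq_prod_lintegral_of_indepFun _ _ hind
    fun i ↦ (hm i).comp (measurable_pi_apply i)]
  refine Finset.prod_congr rfl fun i _ ↦ ?_
  rw [withDensity_apply _ (hs i), ← lintegral_indicator (hs i)]
  exact (measurePreserving_eval μ i).lintegral_comp (hm i)

lemma gaussianReal_eq_withDensity (m m' : ℝ) {v w : NNReal} (hv : v ≠ 0) (hw : w ≠ 0) :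
    gaussianReal m v = (gaussianReal m' w).withDensity
      fun y ↦ ENNReal.ofReal (gaussianPDFReal m v y / gaussianPDFReal m' w y) := by
  rw [gaussianReal_of_var_ne_zero m hv, gaussianReal_of_var_ne_zero m' hw,
    ← withDensity_mul _ (measurable_gaussianPDF m' w) (by fun_prop)]
  congr with y
  rw [Pi.mul_apply, gaussianPDF, gaussianPDF, ← ENNReal.ofReal_mul (gaussianPDFReal_nonneg _ _ _),
    mul_div_cancel₀ _ (gaussianPDFReal_pos _ _ _ hw).ne']

lemma multivariateGaussian_one_eq_map_pi {n : ℕ} (x : EuclideanSpace ℝ (Fin n)) :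
    multivariateGaussian x 1
      = (Measure.pi fun i ↦ gaussianReal (x i) 1).map (WithLp.toLp 2) := by
  have h : ∀ i, gaussianReal (x i) 1 = (gaussianReal 0 1).map (fun y ↦ x i + y) := fun i ↦ by
    rw [gaussianReal_map_const_add, zero_add]
  have h2 : Measure.pi (fun i ↦ gaussianReal (x i) 1)
      = (Measure.pi fun _ ↦ gaussianReal 0 1).map (fun z i ↦ x i + z i) := by
    have : ∀ i, SigmaFinite ((gaussianReal 0 1).map (fun y ↦ x i + y)) := fun i ↦ by
      rw [← h]; infer_instance
    rw [Measure.pi_map_pi (μ := fun _ ↦ gaussianReal 0 1) (f := fun i y ↦ x i + y)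
      (fun i ↦ by fun_prop)]
    simp only [h]
  rw [h2, multivariateGaussian, ← map_pi_eq_stdGaussian, Measure.map_map (by fun_prop) (by fun_prop),
    Measure.map_map (by fun_prop) (by fun_prop)]
  congr 1
  funext z
  ext i
  simp

lemma multivariateGaussian_one_eq_map_add {n : ℕ} (x : EuclideanSpace ℝ (Fin n)) :
    multivariateGaussian x 1 = (stdGaussian (EuclideanSpace ℝ (Fin n))).map (fun z ↦ x + z) := by
  simp [multivariateGaussian]

/-- The logarithm of the density of `N(x, I)` with respect to `N(0, 1 + P)ⁿ`. -/
def logDensity {n : ℕ} (P : ℝ) (x y : EuclideanSpace ℝ (Fin n)) : ℝ :=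
  n / 2 * Real.log (1 + P) - ‖y - x‖ ^ 2 / 2 + ‖y‖ ^ 2 / (2 * (1 + P))

lemma continuous_logDensity {n : ℕ} (P : ℝ) (x : EuclideanSpace ℝ (Fin n)) :
    Continuous (logDensity P x) := by
  unfold logDensity; fun_prop

lemma gaussianPDFReal_div_eq {P : ℝ} (hP : 0 < P) (a y : ℝ) :
    gaussianPDFReal a 1 y / gaussianPDFReal 0 (Real.toNNReal (1 + P)) y
      = Real.exp (1 / 2 * Real.log (1 + P) - (y - a) ^ 2 / 2 + y ^ 2 / (2 * (1 + P))) := by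
  have h1 : 0 < 1 + P := by linarith
  have hs : Real.exp (1 / 2 * Real.log (1 + P)) = √(1 + P) := by
    rw [Real.sqrt_eq_rpow, Real.rpow_def_of_pos h1]; ring_nf
  rw [Real.exp_add, Real.exp_sub, hs]
  simp only [gaussianPDFReal, Real.coe_toNNReal _ h1.le, NNReal.coe_one, mul_one, sub_zero]
  rw [Real.sqrt_mul (by positivity) (1 + P), neg_div, neg_div, Real.exp_neg, Real.exp_neg]
  have : 0 < √(2 * Real.pi) := by positivity
  have : 0 < √(1 + P) := by positivity
  field_simp

instance {n : ℕ} {P : ℝ} : IsProbabilityMeasure (awgnCaod n P) :=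
  Measure.isProbabilityMeasure_map (by fun_prop)

lemma multivariateGaussian_one_eq_withDensity {n : ℕ} {P : ℝ} (hP : 0 < P)
    (x : EuclideanSpace ℝ (Fin n)) :
    multivariateGaussian x 1 = (awgnCaod n P).withDensity
      fun y ↦ ENNReal.ofReal (Real.exp (logDensity P x y)) := by
  have hw : Real.toNNReal (1 + P) ≠ 0 := by simp; linarith
  have h1 : ∀ i, gaussianReal (x i) 1 = (gaussianReal 0 (Real.toNNReal (1 + P))).withDensity
      fun y ↦ ENNReal.ofReal (gaussianPDFReal (x i) 1 y
        / gaussianPDFReal 0 (Real.toNNReal (1 + P)) y) := fun i ↦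
    gaussianReal_eq_withDensity _ _ one_ne_zero hw
  have : ∀ i, SigmaFinite ((gaussianReal 0 (Real.toNNReal (1 + P))).withDensity
      fun y ↦ ENNReal.ofReal (gaussianPDFReal (x i) 1 y
        / gaussianPDFReal 0 (Real.toNNReal (1 + P)) y)) := fun i ↦ by
    rw [← h1]; infer_instance
  have h2 : Measure.pi (fun i ↦ gaussianReal (x i) 1)
      = (Measure.pi fun _ : Fin n ↦ gaussianReal 0 (Real.toNNReal (1 + P))).withDensity
        fun y ↦ ENNReal.ofReal (Real.exp (logDensity P x (WithLp.toLp 2 y))) := by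
    simp_rw [h1]
    rw [pi_withDensity _ fun i ↦ by fun_prop]
    congr with y
    rw [← ENNReal.ofReal_prod_of_nonneg fun i _ ↦ div_nonneg (gaussianPDFReal_nonneg _ _ _)
      (gaussianPDFReal_nonneg _ _ _)]
    simp_rw [gaussianPDFReal_div_eq hP, ← Real.exp_sum]
    congr 2
    rw [logDensity, EuclideanSpace.real_norm_sq_eq, EuclideanSpace.real_norm_sq_eq,
      Finset.sum_add_distrib, Finset.sum_sub_distrib, Finset.sum_div, Finset.sum_div]
    simp
    ring
  have hc := continuous_logDensity P x
  rw [multivariateGaussian_one_eq_map_pi, h2, awgnCaod]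
  ext s hs
  rw [Measure.map_apply (by fun_prop) hs, withDensity_apply _ (hs.preimage (by fun_prop)),
    withDensity_apply _ hs, setLIntegral_map hs (by fun_prop) (by fun_prop)]

end Densities

/-! ### Change of measure and the strong converse. -/

section Converse

/-- Split according to whether the log-likelihood ratio exceeds `τ`: above it bound `φ` by `1`,
below it bound the ratio of densities by `exp τ`. -/
lemma lintegral_withDensity_exp_le {Y : Type*} [MeasurableSpace Y] {μ : Measure Y} {a b : Y → ℝ}
    (ha : Measurable a) (hb : Measurable b) (τ : ℝ) {φ : Y → ENNReal} (hφ : Measurable φ)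
    (hφ1 : ∀ y, φ y ≤ 1) :
    ∫⁻ y, φ y ∂(μ.withDensity fun y ↦ ENNReal.ofReal (Real.exp (a y)))
      ≤ (μ.withDensity fun y ↦ ENNReal.ofReal (Real.exp (a y))) {y | τ < a y - b y}
        + ENNReal.ofReal (Real.exp τ)
          * ∫⁻ y, φ y ∂(μ.withDensity fun y ↦ ENNReal.ofReal (Real.exp (b y))) := by
  have hA : MeasurableSet {y | τ < a y - b y} := measurableSet_lt measurable_const (ha.sub hb)
  rw [lintegral_withDensity_eq_lintegral_mul _ (by fun_prop) hφ,
    lintegral_withDensity_eq_lintegral_mul _ (by fun_prop) hφ, withDensity_apply _ hA,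
    ← lintegral_indicator hA, ← lintegral_const_mul _ (by fun_prop),
    ← lintegral_add_left (Measurable.indicator (by fun_prop) hA)]
  refine lintegral_mono fun y ↦ ?_
  simp only [Pi.mul_apply]
  by_cases hy : y ∈ {y | τ < a y - b y}
  · rw [Set.indicator_of_mem hy]
    exact (mul_le_of_le_one_right' (hφ1 y)).trans le_self_add
  · rw [Set.indicator_of_notMem hy, zero_add, ← mul_assoc, ← ENNReal.ofReal_mul (Real.exp_pos _).le,
      ← Real.exp_add]
    gcongr
    simp only [Set.mem_ofPred_eq, not_lt] at hy
    linarith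

/-- Augustin's strong converse for the maximal probability of error, under a bound on the variance
of the information density. -/
theorem log_card_le_average_add {Y : Type*} [MeasurableSpace Y] {μ : Measure Y} {M : ℕ}
    (hM : M ≠ 0) {a : Fin M → Y → ℝ} {b : Y → ℝ} (ha : ∀ j, Measurable (a j)) (hb : Measurable b)
    (hP : ∀ j, IsProbabilityMeasure (μ.withDensity fun y ↦ ENNReal.ofReal (Real.exp (a j y))))
    (hQ : IsProbabilityMeasure (μ.withDensity fun y ↦ ENNReal.ofReal (Real.exp (b y))))
    {φ : Fin M → Y → ENNReal} (hφ : ∀ j, Measurable (φ j)) (hφ1 : ∀ y, ∑ j, φ j y = 1)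
    {δ V : ℝ} (hδ : 0 < δ) (hV : 0 < V)
    (hsucc : ∀ j, ENNReal.ofReal δ
      ≤ ∫⁻ y, φ j y ∂(μ.withDensity fun y ↦ ENNReal.ofReal (Real.exp (a j y))))
    (hLp : ∀ j, MemLp (fun y ↦ a j y - b y) 2
      (μ.withDensity fun y ↦ ENNReal.ofReal (Real.exp (a j y))))
    (hVar : ∀ j, Var[fun y ↦ a j y - b y;
      μ.withDensity fun y ↦ ENNReal.ofReal (Real.exp (a j y))] ≤ V) :
    Real.log M ≤ (∑ j, ∫ y, (a j y - b y)
        ∂(μ.withDensity fun y ↦ ENNReal.ofReal (Real.exp (a j y)))) / M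
      + √(2 * V / δ) + Real.log (2 / δ) := by
  have hM0 : (0 : ℝ) < M := by exact_mod_cast Nat.pos_of_ne_zero hM
  set P : Fin M → Measure Y := fun j ↦ μ.withDensity fun y ↦ ENNReal.ofReal (Real.exp (a j y))
  set Q : Measure Y := μ.withDensity fun y ↦ ENNReal.ofReal (Real.exp (b y))
  set m : Fin M → ℝ := fun j ↦ ∫ y, (a j y - b y) ∂(P j)
  -- Chosen so that Chebyshev's bound `V / Δ²` is `δ / 2`, leaving half of the success probability
  -- for the change of measure.
  set Δ := √(2 * V / δ) with hΔ
  have hΔ0 : 0 < Δ := Real.sqrt_pos.2 (by positivity)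
  have hΔ2 : V / Δ ^ 2 = δ / 2 := by
    rw [hΔ, Real.sq_sqrt (by positivity)]; field_simp
  have hφle : ∀ j y, φ j y ≤ 1 := fun j y ↦ by
    rw [← hφ1 y]
    exact Finset.single_le_sum (f := fun j ↦ φ j y) (fun _ _ ↦ zero_le) (Finset.mem_univ j)
  have hα1 : ∑ j, ∫⁻ y, φ j y ∂Q = 1 := by
    rw [← lintegral_finsetSum _ fun j _ ↦ hφ j]
    simp [hφ1]
  have hαtop : ∀ j, ∫⁻ y, φ j y ∂Q ≠ ⊤ := fun j ↦
    ((Finset.single_le_sum (f := fun j ↦ ∫⁻ y, φ j y ∂Q) (fun _ _ ↦ zero_le)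
      (Finset.mem_univ j)).trans_lt (hα1 ▸ ENNReal.one_lt_top)).ne
  set α : Fin M → ℝ := fun j ↦ (∫⁻ y, φ j y ∂Q).toReal
  have hαsum : ∑ j, α j = 1 := by
    rw [← ENNReal.toReal_sum fun j _ ↦ hαtop j, hα1, ENNReal.toReal_one]
  have htail : ∀ j, P j {y | m j + Δ < a j y - b y} ≤ ENNReal.ofReal (δ / 2) := fun j ↦ by
    refine (measure_mono fun y hy ↦ ?_).trans
      ((meas_ge_le_variance_div_sq (hLp j) hΔ0).trans (ENNReal.ofReal_le_ofReal ?_))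
    · simp only [Set.mem_ofPred_eq] at hy ⊢
      exact (by linarith : Δ ≤ a j y - b y - m j).trans (le_abs_self _)
    · rw [← hΔ2]
      exact div_le_div_of_nonneg_right (hVar j) (by positivity)
  have hj : ∀ j, δ / 2 * Real.exp (-(m j + Δ)) ≤ α j := fun j ↦ by
    have h1 := (hsucc j).trans
      (lintegral_withDensity_exp_le (ha j) hb (m j + Δ) (hφ j) (hφle j))
    have h2 : ENNReal.ofReal δ ≤ ENNReal.ofReal (δ / 2 + Real.exp (m j + Δ) * α j) := by
      rw [ENNReal.ofReal_add (by positivity) (by positivity),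
        ENNReal.ofReal_mul (Real.exp_pos _).le, ENNReal.ofReal_toReal (hαtop j)]
      exact h1.trans (add_le_add_left (htail j) _)
    have h3 := (ENNReal.ofReal_le_ofReal_iff (by positivity)).1 h2
    rw [Real.exp_neg, ← div_eq_mul_inv, div_le_iff₀ (Real.exp_pos _)]
    linarith
  have hsum : ∑ j, Real.exp (-(m j + Δ)) ≤ 2 / δ := by
    rw [le_div_iff₀ hδ]
    have := Finset.sum_le_sum fun j (_ : j ∈ Finset.univ) ↦ hj j
    rw [hαsum, ← Finset.mul_sum] at this
    linarith
  -- Jensen's inequality with uniform weights turns the bound on the sum of `exp (-(m j + Δ))` into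
  -- a lower bound on the average of the `m j`.
  have hJ := convexOn_exp.map_sum_le (t := Finset.univ) (w := fun _ : Fin M ↦ (M : ℝ)⁻¹)
    (p := fun j ↦ -(m j + Δ)) (fun _ _ ↦ by positivity) (by simp [hM0.ne'])
    (fun _ _ ↦ Set.mem_univ _)
  simp only [smul_eq_mul, ← Finset.mul_sum] at hJ
  have hJ2 := hJ.trans (mul_le_mul_of_nonneg_left hsum (by positivity))
  rw [← Real.le_log_iff_exp_le (by positivity), Real.log_mul (by positivity) (by positivity),
    Real.log_inv, Finset.sum_neg_distrib, Finset.sum_add_distrib] at hJ2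
  simp only [Finset.sum_const, Finset.card_univ, Fintype.card_fin, nsmul_eq_mul] at hJ2
  have e : (M : ℝ)⁻¹ * -(∑ j, m j + M * Δ) = -((∑ j, m j) / M) - Δ := by field_simp; ring
  rw [e] at hJ2
  linarith

end Converse

/-! ### Output law and success probability of deterministic codes. -/

section DeterministicCodes

variable {X Y : Type*} [MeasurableSpace X] [MeasurableSpace Y] {K : Kernel X Y} {M : ℕ}

/-- A Markov kernel from a nonempty space cannot take values in measures on an empty type. -/
lemma Code.card_ne_zero [Nonempty Y] (c : Code K M) : M ≠ 0 := by
  rintro rfl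
  have := c.isMarkovKernel_dec
  have h := measure_univ (μ := c.dec (Classical.arbitrary Y))
  rw [Set.univ_eq_empty_iff.2 inferInstance, measure_empty] at h
  exact zero_ne_one h

lemma Code.outputDist_eq (c : Code K M) {f : Fin M → X} {hf : Measurable f}
    (hc : c.enc = Kernel.deterministic f hf) :
    c.outputDist = (M : ENNReal)⁻¹ • ∑ j, K (f j) := by
  ext s hs
  rw [Code.outputDist, Code.inputDist, hc, Measure.deterministic_comp_eq_map,
    Measure.bind_apply hs (Kernel.aemeasurable _), lintegral_map (K.measurable_coe hs) hf,
    lintegral_fintype]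
  simp [uniformOn_univ, Finset.mul_sum, mul_comm]

lemma Code.ofReal_one_sub_le (c : Code K M) [IsMarkovKernel K] {ε : ℝ} (h : c.MaxErrorLE ε)
    {f : Fin M → X} {hf : Measurable f} (hc : c.enc = Kernel.deterministic f hf) (j : Fin M) :
    ENNReal.ofReal (1 - ε) ≤ ∫⁻ y, c.dec y {j} ∂(K (f j)) := by
  have := c.isMarkovKernel_dec
  have := c.isMarkovKernel_enc
  have : IsMarkovKernel c.decodedLaw := by unfold Code.decodedLaw; infer_instance
  have h1 : c.decodedLaw j {j} = ∫⁻ y, c.dec y {j} ∂(K (f j)) := by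
    rw [Code.decodedLaw, Kernel.comp_apply' _ _ _ (.singleton j), hc,
      Kernel.comp_deterministic_eq_comap, Kernel.comap_apply]
  have h2 := h j
  rw [Code.errorProb, show {i | i ≠ j} = ({j} : Set (Fin M))ᶜ from rfl,
    probReal_compl_eq_one_sub (.singleton j)] at h2
  rw [← h1, ← ofReal_measureReal]
  exact ENNReal.ofReal_le_ofReal (by linarith)

end DeterministicCodes

/-! ### Information density of a Gaussian mixture: moments and variance. -/

section InfoDensity

variable {n M : ℕ} {P : ℝ} {x : Fin M → EuclideanSpace ℝ (Fin n)}

/-- The logarithm of the density of the uniform mixture of the `N(x j, I)` with respect to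
`N(0, 1 + P)ⁿ`. -/
def mixLogDensity (P : ℝ) (x : Fin M → EuclideanSpace ℝ (Fin n)) (y : EuclideanSpace ℝ (Fin n)) :
    ℝ :=
  Real.log (∑ k, Real.exp (logDensity P (x k) y)) - Real.log M

lemma measurable_mixLogDensity : Measurable (mixLogDensity P x) := by
  have := fun k ↦ (continuous_logDensity P (x k)).measurable
  unfold mixLogDensity
  fun_prop

/-- The reference measure cancels, and so do the terms quadratic in `z`, because all components
share the identity covariance; only affine exponents remain. -/
lemma logDensity_sub_mixLogDensity_add [NeZero M] (j : Fin M) (z : EuclideanSpace ℝ (Fin n)) :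
    logDensity P (x j) (x j + z) - mixLogDensity P x (x j + z)
      = Real.log M - logSumExp (fun k ↦ x k - x j) (fun k ↦ -‖x k - x j‖ ^ 2 / 2) z := by
  have e : ∀ k, inner ℝ z (x k - x j) + -‖x k - x j‖ ^ 2 / 2
      = logDensity P (x k) (x j + z) - logDensity P (x j) (x j + z) := fun k ↦ by
    have h := norm_sub_sq_real z (x k - x j)
    rw [show z - (x k - x j) = x j + z - x k by abel] at h
    simp only [logDensity, add_sub_cancel_left]
    linarith
  simp only [logSumExp, e, Real.exp_sub, mixLogDensity]
  rw [← Finset.sum_div, Real.log_div (sum_exp_pos _).ne' (Real.exp_pos _).ne', Real.log_exp]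
  ring

variable {r : ℝ}

lemma hasBoundedSubgradient_logSumExp_sub [NeZero M] (hx : ∀ k, ‖x k‖ ≤ r) (j : Fin M) :
    HasBoundedSubgradient (logSumExp (fun k ↦ x k - x j) (fun k ↦ -‖x k - x j‖ ^ 2 / 2))
      (logSumExpGrad (fun k ↦ x k - x j) (fun k ↦ -‖x k - x j‖ ^ 2 / 2)) (2 * r) :=
  logSumExp_hasBoundedSubgradient fun k ↦
    (norm_sub_le _ _).trans (by linarith [hx k, hx j])

lemma memLp_logDensity_sub_mixLogDensity [NeZero M] (hx : ∀ k, ‖x k‖ ≤ r) (j : Fin M) :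
    MemLp (fun y ↦ logDensity P (x j) y - mixLogDensity P x y) 2
      (multivariateGaussian (x j) 1) := by
  have hm : Measurable fun y ↦ logDensity P (x j) y - mixLogDensity P x y :=
    (continuous_logDensity P (x j)).measurable.sub measurable_mixLogDensity
  rw [multivariateGaussian_one_eq_map_add, memLp_map_measure_iff hm.aestronglyMeasurable
    (by fun_prop)]
  refine MemLp.congr_norm (f := fun z ↦ Real.log M
    - logSumExp (fun k ↦ x k - x j) (fun k ↦ -‖x k - x j‖ ^ 2 / 2) z) ?_
    (hm.comp (by fun_prop)).aestronglyMeasurable (ae_of_all _ fun z ↦ ?_)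
  · exact (memLp_const _).sub (hasBoundedSubgradient_logSumExp_sub hx j).memLp_two
  · simp only [Function.comp_apply, logDensity_sub_mixLogDensity_add]

lemma variance_logDensity_sub_mixLogDensity_le [NeZero M] (hx : ∀ k, ‖x k‖ ≤ r) (j : Fin M) :
    Var[fun y ↦ logDensity P (x j) y - mixLogDensity P x y; multivariateGaussian (x j) 1]
      ≤ Real.pi ^ 2 * r ^ 2 := by
  have hm : Measurable fun y ↦ logDensity P (x j) y - mixLogDensity P x y :=
    (continuous_logDensity P (x j)).measurable.sub measurable_mixLogDensity
  rw [multivariateGaussian_one_eq_map_add, variance_map hm.aemeasurable (by fun_prop)]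
  have e : (fun y ↦ logDensity P (x j) y - mixLogDensity P x y) ∘ (fun z ↦ x j + z)
      = fun z ↦ Real.log M
        - logSumExp (fun k ↦ x k - x j) (fun k ↦ -‖x k - x j‖ ^ 2 / 2) z := by
    funext z
    exact logDensity_sub_mixLogDensity_add j z
  have hb := hasBoundedSubgradient_logSumExp_sub hx j
  rw [e, variance_const_sub hb.memLp_two.aestronglyMeasurable]
  have := hb.variance_le
  linarith

lemma inv_smul_sum_multivariateGaussian_eq_withDensity [NeZero M] (hP : 0 < P) :
    (M : ENNReal)⁻¹ • ∑ j, multivariateGaussian (x j) 1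
      = (awgnCaod n P).withDensity fun y ↦ ENNReal.ofReal (Real.exp (mixLogDensity P x y)) := by
  have hM0 : (0 : ℝ) < M := by exact_mod_cast Nat.pos_of_ne_zero (NeZero.ne M)
  have hc := fun j ↦ (continuous_logDensity P (x j)).measurable
  have e : (fun y ↦ ENNReal.ofReal (Real.exp (mixLogDensity P x y)))
      = (M : ENNReal)⁻¹ • fun y ↦ ∑ j, ENNReal.ofReal (Real.exp (logDensity P (x j) y)) := by
    funext y
    rw [mixLogDensity, Real.exp_sub, Real.exp_log (sum_exp_pos _), Real.exp_log hM0,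
      div_eq_inv_mul, ENNReal.ofReal_mul (by positivity), ENNReal.ofReal_inv_of_pos hM0,
      ENNReal.ofReal_natCast, ENNReal.ofReal_sum_of_nonneg fun _ _ ↦ (Real.exp_pos _).le]
    rfl
  rw [e, withDensity_smul _ (by fun_prop)]
  congr 1
  ext s hs
  rw [withDensity_apply _ hs, lintegral_finsetSum _ fun j _ ↦ by fun_prop, Measure.finsetSum_apply]
  refine Finset.sum_congr rfl fun j _ ↦ ?_
  rw [multivariateGaussian_one_eq_withDensity hP, withDensity_apply _ hs]

lemma integral_norm_sq_stdGaussian :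
    ∫ z, ‖z‖ ^ 2 ∂(stdGaussian (EuclideanSpace ℝ (Fin n))) = n := by
  simp_rw [← (EuclideanSpace.basisFun (Fin n) ℝ).sum_sq_inner_right]
  rw [integral_finsetSum _ fun i _ ↦ (memLp_inner_stdGaussian _).integrable_sq]
  rw [Finset.sum_congr rfl fun i _ ↦ integral_inner_sq_stdGaussian _]
  simp

lemma logDensity_self_add (u z : EuclideanSpace ℝ (Fin n)) :
    logDensity P u (u + z) = (n / 2 * Real.log (1 + P) + ‖u‖ ^ 2 / (2 * (1 + P)))
      + (2 / (2 * (1 + P))) * inner ℝ u z + (1 / (2 * (1 + P)) - 1 / 2) * ‖z‖ ^ 2 := by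
  rw [logDensity, add_sub_cancel_left, norm_add_sq_real]
  ring

lemma integrable_logDensity (u : EuclideanSpace ℝ (Fin n)) :
    Integrable (logDensity P u) (multivariateGaussian u 1) := by
  rw [multivariateGaussian_one_eq_map_add, integrable_map_measure
    (continuous_logDensity P u).aestronglyMeasurable (by fun_prop)]
  have h1 := (memLp_inner_stdGaussian u).integrable one_le_two
  have h2 := integrable_norm_sq_stdGaussian (E := EuclideanSpace ℝ (Fin n))
  simp only [Function.comp_def, logDensity_self_add]
  fun_prop

lemma integral_logDensity_le (hP : 0 < P) {u : EuclideanSpace ℝ (Fin n)} (hu : ‖u‖ ^ 2 ≤ n * P) :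
    ∫ y, logDensity P u y ∂(multivariateGaussian u 1) ≤ n * awgnCapacity P := by
  have h1 := (memLp_inner_stdGaussian u).integrable one_le_two
  have h2 := integrable_norm_sq_stdGaussian (E := EuclideanSpace ℝ (Fin n))
  rw [multivariateGaussian_one_eq_map_add, integral_map (by fun_prop)
    (continuous_logDensity P u).aestronglyMeasurable]
  simp only [logDensity_self_add]
  rw [integral_add (by fun_prop) (by fun_prop), integral_add (by fun_prop) (by fun_prop),
    integral_const_mul, integral_const_mul, integral_inner_stdGaussian,
    integral_norm_sq_stdGaussian, integral_const, probReal_univ, awgnCapacity]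
  have h3 : ‖u‖ ^ 2 / (2 * (1 + P)) ≤ n * P / (2 * (1 + P)) := by gcongr
  -- At full power `‖u‖² = nP`, the signal and noise contributions cancel exactly, leaving `nC`.
  have h4 : n * P / (2 * (1 + P)) + (1 / (2 * (1 + P)) - 1 / 2) * n = 0 := by
    field_simp; ring
  simp only [one_smul, mul_zero, add_zero]
  linarith

end InfoDensity

/-! ### The relative entropy bound and its asymptotic consequence. -/

section Main

lemma llr_withDensity_exp {α : Type*} [MeasurableSpace α] {μ : Measure α} [SigmaFinite μ]
    {b : α → ℝ} (hb : Measurable b) :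
    llr (μ.withDensity fun y ↦ ENNReal.ofReal (Real.exp (b y))) μ
      =ᵐ[μ.withDensity fun y ↦ ENNReal.ofReal (Real.exp (b y))] b := by
  refine (withDensity_absolutelyContinuous _ _).ae_le ?_
  filter_upwards [Measure.rnDeriv_withDensity μ
    (f := fun y ↦ ENNReal.ofReal (Real.exp (b y))) (by fun_prop)] with y hy
  rw [llr, hy, ENNReal.toReal_ofReal (Real.exp_pos _).le, Real.log_exp]

/-- The constant in the bound on the relative entropy. -/
def klConstant (ε P : ℝ) : ℝ :=
  √(2 * (Real.pi ^ 2 * P) / (1 - ε)) + Real.log (2 / (1 - ε))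

lemma klConstant_pos {ε P : ℝ} (hε0 : 0 < ε) (hε1 : ε < 1) : 0 < klConstant ε P := by
  have h1 : 0 < 1 - ε := by linarith
  refine add_pos_of_nonneg_of_pos (Real.sqrt_nonneg _) (Real.log_pos ?_)
  rw [one_lt_div h1]
  linarith

theorem klDiv_outputDist_le {ε P : ℝ} (hε0 : 0 < ε) (hε1 : ε < 1) (hP : 0 < P) {n : ℕ}
    (hn : 1 ≤ n) {M : ℕ} (c : Code (awgn n P) M) (hc : c.IsMaxDet ε) :
    InformationTheory.klDiv c.outputDist (awgnCaod n P) ≠ ⊤ ∧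
      (InformationTheory.klDiv c.outputDist (awgnCaod n P)).toReal ≤
        n * awgnCapacity P - Real.log M + klConstant ε P * √(n : ℝ) := by
  obtain ⟨herr, f, hf, henc⟩ := hc
  have hM := c.card_ne_zero
  have : NeZero M := ⟨hM⟩
  have hM0 : (0 : ℝ) < M := by exact_mod_cast Nat.pos_of_ne_zero hM
  have hn0 : (1 : ℝ) ≤ n := by exact_mod_cast hn
  have hδ : 0 < 1 - ε := by linarith
  set x : Fin M → EuclideanSpace ℝ (Fin n) := fun j ↦ f j
  have hx : ∀ j, ‖x j‖ ≤ √(n * P) := fun j ↦ (f j).2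
  have hr2 : √(n * P) ^ 2 = n * P := Real.sq_sqrt (by positivity)
  have hx2 : ∀ j, ‖x j‖ ^ 2 ≤ n * P := fun j ↦ by
    rw [← hr2]
    exact pow_le_pow_left₀ (norm_nonneg _) (hx j) 2
  have hout : c.outputDist = (M : ENNReal)⁻¹ • ∑ j, multivariateGaussian (x j) 1 :=
    c.outputDist_eq henc
  have hwd := inv_smul_sum_multivariateGaussian_eq_withDensity (x := x) hP
  have hPj := fun j ↦ multivariateGaussian_one_eq_withDensity hP (x j)
  have hb : Measurable (mixLogDensity P x) := measurable_mixLogDensity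
  have hQ : IsProbabilityMeasure c.outputDist := by
    constructor
    rw [hout]
    simp [ENNReal.inv_mul_cancel, hM]
  have hLp := fun j ↦ memLp_logDensity_sub_mixLogDensity (P := P) hx j
  have hbint : ∀ j, Integrable (mixLogDensity P x) (multivariateGaussian (x j) 1) := fun j ↦ by
    -- The mixture log-density is the component log-density minus the information density, both
    -- integrable under component `j`.
    have := (integrable_logDensity (P := P) (x j)).sub ((hLp j).integrable one_le_two)
    simpa [Pi.sub_def] using this
  have hbQ : Integrable (mixLogDensity P x) c.outputDist := by
    rw [hout]
    refine Integrable.smul_measure ?_ (by simp [hM])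
    exact integrable_finsetSum_measure.2 fun j _ ↦ hbint j
  have hac : c.outputDist ≪ awgnCaod n P := by
    rw [hout, hwd]
    exact withDensity_absolutelyContinuous _ _
  have hllr : llr c.outputDist (awgnCaod n P) =ᵐ[c.outputDist] mixLogDensity P x := by
    rw [hout, hwd]
    exact llr_withDensity_exp hb
  refine ⟨InformationTheory.klDiv_ne_top hac (hbQ.congr hllr.symm), ?_⟩
  rw [InformationTheory.toReal_klDiv_of_measure_eq hac (by simp), integral_congr_ae hllr]
  have hKL : ∫ y, mixLogDensity P x y ∂c.outputDist
      = (∑ j, ∫ y, logDensity P (x j) y ∂(multivariateGaussian (x j) 1)) / M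
        - (∑ j, ∫ y, (logDensity P (x j) y - mixLogDensity P x y)
            ∂(multivariateGaussian (x j) 1)) / M := by
    rw [hout, integral_smul_measure, integral_finsetSum_measure fun j _ ↦ hbint j, ← sub_div,
      ← Finset.sum_sub_distrib, ENNReal.toReal_inv, ENNReal.toReal_natCast, smul_eq_mul,
      div_eq_inv_mul]
    congr 1
    refine Finset.sum_congr rfl fun j _ ↦ ?_
    rw [integral_sub (integrable_logDensity _) (hbint j)]
    ring
  have hcap : (∑ j, ∫ y, logDensity P (x j) y ∂(multivariateGaussian (x j) 1)) / M
      ≤ n * awgnCapacity P := by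
    rw [div_le_iff₀ hM0]
    refine (Finset.sum_le_sum fun j _ ↦ integral_logDensity_le hP (hx2 j)).trans (le_of_eq ?_)
    simp [mul_comm]
  have hdec := c.isMarkovKernel_dec
  -- `V` is the Poincaré constant `π² / 4` times the square of the gradient bound `2√(nP)`.
  have hconv := log_card_le_average_add (μ := awgnCaod n P) hM
    (a := fun j ↦ logDensity P (x j)) (b := mixLogDensity P x)
    (φ := fun j y ↦ c.dec y {j}) (δ := 1 - ε) (V := Real.pi ^ 2 * (n * P))
    (fun j ↦ (continuous_logDensity P (x j)).measurable) hb
    (fun j ↦ by rw [← hPj]; infer_instance)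
    (by rw [← hwd, ← hout]; exact hQ)
    (fun j ↦ c.dec.measurable_coe (.singleton j))
    (fun y ↦ by simp) hδ (by positivity)
    (fun j ↦ by rw [← hPj]; exact c.ofReal_one_sub_le herr henc j)
    (fun j ↦ by rw [← hPj]; exact hLp j)
    (fun j ↦ by
      rw [← hPj, ← hr2]
      exact variance_logDensity_sub_mixLogDensity_le hx j)
  simp only [← hPj] at hconv
  have hsq : √(2 * (Real.pi ^ 2 * (n * P)) / (1 - ε))
      = √(2 * (Real.pi ^ 2 * P) / (1 - ε)) * √(n : ℝ) := by
    rw [← Real.sqrt_mul (by positivity)]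
    congr 1
    ring
  -- The logarithm is nonnegative and `n ≥ 1`, so the additive constant is absorbed into the `√n`
  -- term.
  have hlog : Real.log (2 / (1 - ε)) ≤ Real.log (2 / (1 - ε)) * √(n : ℝ) := by
    refine le_mul_of_one_le_right (Real.log_nonneg ?_) (Real.one_le_sqrt.2 hn0)
    rw [le_div_iff₀ hδ]
    linarith
  rw [hKL, klConstant, add_mul]
  rw [hsq] at hconv
  linarith

theorem tendsto_klDiv_outputDist_div {ε P : ℝ} (hε0 : 0 < ε) (hε1 : ε < 1) (hP : 0 < P)
    {M : ℕ → ℕ} (c : ∀ n : ℕ, Code (awgn n P) (M n)) (hc : ∀ n : ℕ, 1 ≤ n → (c n).IsMaxDet ε)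
    (hM : Tendsto (fun n : ℕ ↦ 1 / (n : ℝ) * Real.log (M n)) atTop (𝓝 (awgnCapacity P))) :
    Tendsto (fun n : ℕ ↦ InformationTheory.klDiv (c n).outputDist (awgnCaod n P) / n)
      atTop (𝓝 0) := by
  have hlim : Tendsto (fun n : ℕ ↦ awgnCapacity P - 1 / (n : ℝ) * Real.log (M n)
      + klConstant ε P * √((n : ℝ)⁻¹)) atTop
      (𝓝 (awgnCapacity P - awgnCapacity P + klConstant ε P * √0)) :=
    (tendsto_const_nhds.sub hM).add
      (((Real.continuous_sqrt.tendsto 0).comp tendsto_inv_atTop_nhds_zero_nat).const_mul _)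
  rw [Real.sqrt_zero, mul_zero, sub_self, add_zero] at hlim
  have hlim2 := ENNReal.tendsto_ofReal hlim
  rw [ENNReal.ofReal_zero] at hlim2
  refine tendsto_of_tendsto_of_tendsto_of_le_of_le' tendsto_const_nhds hlim2
    (Eventually.of_forall fun _ ↦ zero_le) ?_
  filter_upwards [eventually_ge_atTop 1] with n hn
  obtain ⟨h1, h2⟩ := klDiv_outputDist_le hε0 hε1 hP hn (c n) (hc n hn)
  have hn0 : (0 : ℝ) < n := by exact_mod_cast hn
  rw [← ENNReal.ofReal_toReal h1, ← ENNReal.ofReal_natCast n, ← ENNReal.ofReal_div_of_pos hn0]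
  refine ENNReal.ofReal_le_ofReal ((div_le_div_of_nonneg_right h2 hn0.le).trans (le_of_eq ?_))
  have hs : √(n : ℝ) / n = √((n : ℝ)⁻¹) := by
    rw [Real.sqrt_div_self, Real.sqrt_inv]
  rw [add_div, sub_div, mul_div_assoc (klConstant ε P), hs, mul_div_cancel_left₀ _ hn0.ne']
  ring

end Main

end ChannelCoding

end

theorem mainTheorem2 (ε P : ℝ) (hε0 : 0 < ε) (hε1 : ε < 1) (hP : 0 < P) :
    (∃ a : ℝ, 0 < a ∧
      ∀ (n : ℕ), 1 ≤ n → ∀ (M : ℕ) (c : ChannelCoding.Code (ChannelCoding.awgn n P) M),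
        c.IsMaxDet ε →
          InformationTheory.klDiv c.outputDist (ChannelCoding.awgnCaod n P) ≠ ⊤ ∧
          (InformationTheory.klDiv c.outputDist (ChannelCoding.awgnCaod n P)).toReal ≤
            n * ChannelCoding.awgnCapacity P - Real.log M + a * √(n : ℝ)) ∧
    (∀ (M : ℕ → ℕ) (c : ∀ n : ℕ, ChannelCoding.Code (ChannelCoding.awgn n P) (M n)),
      (∀ n : ℕ, 1 ≤ n → (c n).IsMaxDet ε) →
      Tendsto (fun n : ℕ ↦ 1 / (n : ℝ) * Real.log (M n)) atTop
        (𝓝 (ChannelCoding.awgnCapacity P)) →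
      Tendsto (fun n : ℕ ↦
        InformationTheory.klDiv (c n).outputDist (ChannelCoding.awgnCaod n P) / n)
        atTop (𝓝 0)) :=
  ⟨⟨ChannelCoding.klConstant ε P, ChannelCoding.klConstant_pos hε0 hε1, fun _ hn _ c hc ↦
    ChannelCoding.klDiv_outputDist_le hε0 hε1 hP hn c hc⟩,
    fun _ c hc hM ↦ ChannelCoding.tendsto_klDiv_outputDist_div hε0 hε1 hP c hc hM⟩
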